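/- Let $H$ be a complex separable Hilbert space. Let $\mathcal S_4$ be the Schatten class of compact operators $A$ on $H$ whose singular values $\sigma_1(A),\sigma_2(A),\dots$ (the square roots of the eigenvalues of $A^*A$, repeated according to multiplicity) satisfy $\sum_i \sigma_i(A)^4<\infty$, with the norm $\|A\|_{\mathcal S_4}=\bigl(\sum_i\sigma_i(A)^4\bigr)^{1/4}$. Let $L_4=L_4((0,1),\mathbb R)$ with respect to Lebesgue measure. Then for any $A,B\in\mathcal S_4$ the real space $\operatorname{span}_{\mathbb R}\{A,B\}$ is contained in $\mathcal S_4$ and, with the $\mathcal S_4$ norm, embeds linearly and isometrically into $L_4$: there is an $\mathbb R$-linear map $T:\operatorname{span}_{\mathbb R}\{A,B\}\to L_4$ with $\|TX\|_{L_4}=\|X\|_{\mathcal S_4}$ for every $X\in\operatorname{span}_{\mathbb R}\{A,B\}$. -/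

import Mathlib

open MeasureTheory

/-- The eigenspace of the positive operator `A* A` for the eigenvalue `s ^ 2`. Its dimension is the
multiplicity of `s` as a singular value of `A`. -/
noncomputable def singularSpace {H : Type*} [NormedAddCommGroup H] [InnerProductSpace ℂ H] [CompleteSpace H]
    (A : H →L[ℂ] H) (s : ℝ) : Submodule ℂ H :=
  Module.End.eigenspace
    (((ContinuousLinearMap.adjoint A).comp A : H →L[ℂ] H) : Module.End ℂ H) ((s : ℂ) ^ 2)

/-- Index set of the nonzero singular values of a compact operator `A`: each `s > 0` occurs as often
as its (finite) multiplicity. -/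
def SingularIndex {H : Type*} [NormedAddCommGroup H] [InnerProductSpace ℂ H] [CompleteSpace H]
    (A : H →L[ℂ] H) : Type :=
  Σ s : {s : ℝ // 0 < s}, Fin (Module.finrank ℂ (singularSpace A s.1))

/-- The family of nonzero singular values of a compact operator, repeated according to
multiplicity. -/
def singularValue {H : Type*} [NormedAddCommGroup H] [InnerProductSpace ℂ H] [CompleteSpace H]
    (A : H →L[ℂ] H) (i : SingularIndex A) : ℝ :=
  i.1.1

/-- Membership in the Schatten class `S_p`: `A` is compact and its singular values are
`p`-summable. -/
def MemSchatten {H : Type*} [NormedAddCommGroup H] [InnerProductSpace ℂ H] [CompleteSpace H]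
    (p : ℝ) (A : H →L[ℂ] H) : Prop :=
  IsCompactOperator A ∧ Summable fun i : SingularIndex A => singularValue A i ^ p

/-- The Schatten norm `(∑ σ_i(A) ^ p) ^ (1 / p)`, meaningful for `A` in `S_p`. -/
noncomputable def schattenNorm {H : Type*} [NormedAddCommGroup H] [InnerProductSpace ℂ H]
    [CompleteSpace H] (p : ℝ) (A : H →L[ℂ] H) : ℝ :=
  (∑' i : SingularIndex A, singularValue A i ^ p) ^ (1 / p)

/-!
Writing `X = xA + yB`, one has `‖X‖⁴ = ‖X* X‖²` with the Schatten norm on the left and the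
Hilbert–Schmidt norm on the right, so the fourth power of the norm is a binary quartic form in
`(x, y)`. Let `L` be the functional on polynomials of degree at most four that sends
`(x + y t) ^ 4` to this form. Its value on the square of `(x + y t) (z + w t)` is a positive
combination of the Hilbert–Schmidt inner product of two positive operators and a squared norm, hence
nonnegative. A nonnegative polynomial in one variable minus its minimum has a double root, so it is
a sum of squares of products of real linear factors, and `L` is nonnegative on it. By Hahn–Banach,
`L` is integration against a measure on the compact half circle of angles, so that
`‖xA + yB‖⁴ = ∫ (x cos θ + y sin θ)⁴`. A probability measure on a standard Borel space is an image
of Lebesgue measure on `(0, 1)`, which transports the linear forms into `L₄(0, 1)`.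
-/

section TruncatedMoments

open Polynomial Real

lemma eval_nonneg_of_sq_mul_eval_nonneg {r : ℝ[X]} {t : ℝ}
    (h : ∀ x, 0 ≤ ((X - C t) ^ 2 * r).eval x) (x : ℝ) : 0 ≤ r.eval x := by
  have hclosed : IsClosed {x | 0 ≤ r.eval x} := isClosed_le continuous_const r.continuous
  refine hclosed.closure_subset_iff.2 (fun y (hy : y ≠ t) ↦ ?_) (dense_compl_singleton t x)
  have hpos : 0 < (y - t) ^ 2 := by have := sub_ne_zero.2 hy; positivity
  exact nonneg_of_mul_nonneg_right (by simpa using h y) hpos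

lemma sq_X_sub_C_dvd_of_forall_eval_nonneg {q : ℝ[X]} (hq : ∀ x, 0 ≤ q.eval x) {t : ℝ}
    (ht : q.eval t = 0) : (X - C t) ^ 2 ∣ q := by
  rcases eq_or_ne q 0 with rfl | hq0
  · exact dvd_zero _
  have hmin : IsLocalMin (fun x ↦ q.eval x) t := .of_forall fun x ↦ by simpa [ht] using hq x
  have hderiv : q.derivative.eval t = 0 := hmin.hasDerivAt_eq_zero (q.hasDerivAt t)
  exact (le_rootMultiplicity_iff hq0).1 ((one_lt_rootMultiplicity_iff_isRoot hq0).2 ⟨ht, hderiv⟩)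

lemma exists_eq_C_add_sq_mul_of_forall_eval_nonneg {p : ℝ[X]} (hp : ∀ x, 0 ≤ p.eval x) :
    ∃ (m t : ℝ) (r : ℝ[X]), 0 ≤ m ∧ (∀ x, 0 ≤ r.eval x) ∧ r.natDegree ≤ p.natDegree - 2 ∧
      p = C m + (X - C t) ^ 2 * r := by
  obtain ⟨t, ht⟩ := p.exists_forall_norm_le
  simp only [norm_of_nonneg (hp _)] at ht
  have hq : ∀ x, 0 ≤ (p - C (p.eval t)).eval x := fun x ↦ by simpa using ht x
  obtain ⟨r, hr⟩ := sq_X_sub_C_dvd_of_forall_eval_nonneg hq (t := t) (by simp)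
  refine ⟨p.eval t, t, r, hp t, eval_nonneg_of_sq_mul_eval_nonneg (hr ▸ hq), ?_,
    by rw [← hr, add_sub_cancel]⟩
  rcases eq_or_ne r 0 with rfl | hr0
  · simp
  · have hdeg := congrArg natDegree hr
    rw [natDegree_sub_C, natDegree_mul (pow_ne_zero 2 (X_sub_C_ne_zero t)) hr0, natDegree_pow,
      natDegree_X_sub_C] at hdeg
    lia

section Moments

variable {K ι : Type*} [TopologicalSpace K] [CompactSpace K] [MeasurableSpace K] [BorelSpace K]

lemma convex_range_integral (φ : ι → C(K, ℝ)) :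
    Convex ℝ (Set.range fun (ρ : ProbabilityMeasure K) i ↦ ∫ z, φ i z ∂(ρ : Measure K)) := by
  rintro _ ⟨μ, rfl⟩ _ ⟨ν, rfl⟩ s t hs ht hst
  have hρ : IsProbabilityMeasure
      (ENNReal.ofReal s • (μ : Measure K) + ENNReal.ofReal t • (ν : Measure K)) :=
    ⟨by simp [← ENNReal.ofReal_add hs ht, hst]⟩
  have hint (i) (ρ : ProbabilityMeasure K) (c : ℝ) :
      Integrable (φ i) (ENNReal.ofReal c • (ρ : Measure K)) :=
    ((φ i).continuous.integrable_of_hasCompactSupport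
      (.of_compactSpace _)).smul_measure ENNReal.ofReal_ne_top
  refine ⟨⟨_, hρ⟩, funext fun i ↦ ?_⟩
  simp [integral_add_measure (hint i μ s) (hint i ν t), hs, ht]

lemma isClosed_range_integral [T2Space K] (φ : ι → C(K, ℝ)) :
    IsClosed (Set.range fun (ρ : ProbabilityMeasure K) i ↦ ∫ z, φ i z ∂(ρ : Measure K)) :=
  (isCompact_range (continuous_pi fun i ↦
    ProbabilityMeasure.continuous_integral_continuousMap (φ i))).isClosed

theorem exists_probabilityMeasure_forall_integral_eq [T2Space K] [Fintype ι] (φ : ι → C(K, ℝ))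
    (c : ι → ℝ) (hc : ∀ (a : ι → ℝ) (r : ℝ), (∀ z, r ≤ ∑ i, a i * φ i z) → r ≤ ∑ i, a i * c i) :
    ∃ ρ : ProbabilityMeasure K, ∀ i, ∫ z, φ i z ∂(ρ : Measure K) = c i := by
  classical
  suffices c ∈ Set.range fun (ρ : ProbabilityMeasure K) i ↦ ∫ z, φ i z ∂(ρ : Measure K) by
    simpa [funext_iff] using this
  by_contra hcr
  obtain ⟨f, r, hfc, hf⟩ :=
    geometric_hahn_banach_point_closed (convex_range_integral φ) (isClosed_range_integral φ) hcr
  obtain ⟨a, ha⟩ : ∃ a : ι → ℝ, ∀ x, f x = ∑ i, a i * x i :=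
    ⟨_, fun x ↦ by simpa [mul_comm] using (f : (ι → ℝ) →ₗ[ℝ] ℝ).pi_apply_eq_sum_univ x⟩
  refine hfc.not_ge ((hc a r fun z ↦ ?_).trans_eq (ha c).symm)
  rw [← ha fun i ↦ φ i z]
  exact (hf _ ⟨⟨Measure.dirac z, inferInstance⟩, funext fun i ↦ integral_dirac _ _⟩).le

end Moments

lemma measurePreserving_projIcc : MeasurePreserving (Set.projIcc (0 : ℝ) 1 zero_le_one)
    (volume.restrict (Set.Ioo 0 1)) volume where
  measurable := continuous_projIcc.measurable
  map_eq := by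
    have hid : Set.projIcc (0 : ℝ) 1 zero_le_one ∘ Subtype.val = id := by ext; simp
    rw [restrict_Ioo_eq_restrict_Icc, ← unitInterval.measurePreserving_coe.map_eq,
      Measure.map_map continuous_projIcc.measurable measurable_subtype_coe, hid, Measure.map_id]

theorem nonempty_linearIsometry_Lp_Ioo {Y : Type*} [MeasurableSpace Y] [StandardBorelSpace Y]
    (ρ : ProbabilityMeasure Y) (E 𝕜 : Type*) [NormedAddCommGroup E] [NormedRing 𝕜] [Module 𝕜 E]
    [IsBoundedSMul 𝕜 E] (p : ENNReal) [Fact (1 ≤ p)] :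
    Nonempty (Lp E p (ρ : Measure Y) →ₗᵢ[𝕜] Lp E p (volume.restrict (Set.Ioo (0 : ℝ) 1))) := by
  have : Nonempty Y := ρ.nonempty
  obtain ⟨f, hf, hfρ⟩ := Measure.exists_measurable_map_eq (ρ : Measure Y)
  exact ⟨Lp.compMeasurePreservingₗᵢ 𝕜 _ (.comp ⟨hf, hfρ⟩ measurePreserving_projIcc)⟩

lemma norm_toLp_pow_of_even {Y : Type*} [MeasurableSpace Y] {μ : Measure Y} {N : ℕ} (hN : Even N)
    (hN0 : N ≠ 0) {f : Y → ℝ} (hf : MemLp f N μ) : ‖hf.toLp f‖ ^ N = ∫ z, f z ^ N ∂μ := by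
  rw [Lp.norm_toLp, toReal_eLpNorm hf.1,
    lpNorm_eq_integral_norm_rpow_toReal (by simpa) (by simp) hf.1]
  simp only [ENNReal.toReal_natCast, rpow_natCast, hN.pow_abs, norm_eq_abs]
  exact rpow_inv_natCast_pow (integral_nonneg fun z ↦ hN.pow_nonneg _) hN0

/-- The compact set of angles `θ` parametrizing the slopes `tan θ`, including the slope at infinity;
truncated moment sequences on `ℝ` are integrated over it instead of over the line. -/
abbrev LineAngle : Type := Set.Icc (-(π / 2)) (π / 2)

/-- The angle of slope `t`. -/
noncomputable def LineAngle.ofSlope (t : ℝ) : LineAngle :=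
  ⟨arctan t, Set.Ioo_subset_Icc_self (arctan_mem_Ioo t)⟩

/-- The monomial `x ^ (d - k) * y ^ k` of degree `d` restricted to the points
`(cos θ, sin θ)` of the half circle; only `k ≤ d` is meaningful. -/
noncomputable def angularMonomial (d k : ℕ) : C(LineAngle, ℝ) where
  toFun θ := Real.cos θ ^ (d - k) * Real.sin θ ^ k

/-- The restrictions of the linear forms `x * X + y * Y` to the half circle, as a linear
function of the coefficients `(x, y)`. -/
noncomputable def angularForm : ℝ × ℝ →ₗ[ℝ] C(LineAngle, ℝ) where
  toFun v := ⟨fun θ ↦ v.1 * Real.cos θ + v.2 * Real.sin θ, by fun_prop⟩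
  map_add' v w := by ext θ; simp [add_mul, add_add_add_comm]
  map_smul' c v := by ext θ; simp [mul_add, mul_assoc]

lemma one_add_sq_pow_mul_angularMonomial_ofSlope {n k : ℕ} (hk : k ≤ 2 * n) (t : ℝ) :
    (1 + t ^ 2) ^ n * angularMonomial (2 * n) k (LineAngle.ofSlope t) = t ^ k := by
  have : 0 < √(1 + t ^ 2) := sqrt_pos.2 (by positivity)
  have hsq : (1 + t ^ 2) ^ n = √(1 + t ^ 2) ^ (2 * n - k) * √(1 + t ^ 2) ^ k := by
    rw [← pow_add, Nat.sub_add_cancel hk, pow_mul, sq_sqrt (by positivity)]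
  simp only [angularMonomial, LineAngle.ofSlope, ContinuousMap.coe_mk, cos_arctan, sin_arctan,
    hsq, div_pow, one_pow]
  field_simp

lemma add_C_mul_X_pow (x y : ℝ) (d : ℕ) : (C x + C y * X) ^ d =
    ∑ k ∈ Finset.range (d + 1), (x ^ (d - k) * y ^ k * d.choose k) • X ^ k := by
  rw [add_comm, add_pow]
  refine Finset.sum_congr rfl fun k _ ↦ ?_
  simp only [smul_eq_C_mul, map_mul, map_pow, map_natCast]
  ring

lemma angularForm_pow_apply (v : ℝ × ℝ) (d : ℕ) (θ : LineAngle) : angularForm v θ ^ d =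
    ∑ k ∈ Finset.range (d + 1), (v.1 ^ (d - k) * v.2 ^ k * d.choose k) * angularMonomial d k θ := by
  simp only [angularForm, angularMonomial, LinearMap.coe_mk, AddHom.coe_mk, ContinuousMap.coe_mk]
  rw [add_comm, add_pow]
  exact Finset.sum_congr rfl fun k _ ↦ by ring

/-- Positivity of a functional on the squares of products of `n` real linear factors; a constant
factor `C α` stands for the root at infinity. -/
def NonnegOnSplitSquares (n : ℕ) (L : ℝ[X] →ₗ[ℝ] ℝ) : Prop :=
  ∀ α β : Fin n → ℝ, 0 ≤ L ((∏ i, (C (α i) + C (β i) * X)) ^ 2)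

namespace NonnegOnSplitSquares

variable {n : ℕ} {L : ℝ[X] →ₗ[ℝ] ℝ}

lemma comp_mulLeft_sq (hL : NonnegOnSplitSquares (n + 1) L) (t : ℝ) :
    NonnegOnSplitSquares n (L ∘ₗ LinearMap.mulLeft ℝ ((X - C t) ^ 2)) := fun α β ↦ by
  have h := hL (Fin.cons (-t) α) (Fin.cons 1 β)
  rw [Fin.prod_univ_succ, mul_pow] at h
  simpa [neg_add_eq_sub] using h

lemma map_C_nonneg (hL : NonnegOnSplitSquares n L) {m : ℝ} (hm : 0 ≤ m) : 0 ≤ L (C m) := by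
  have h1 : 0 ≤ L 1 := by simpa using hL 1 0
  rw [← mul_one (C m), ← smul_eq_C_mul, map_smul]
  exact mul_nonneg hm h1

/-- Subtracting its minimum from a nonnegative polynomial creates a double root, which can be
split off; hence nonnegative polynomials are sums of squares of split polynomials. -/
theorem map_nonneg (hL : NonnegOnSplitSquares n L) {p : ℝ[X]} (hdeg : p.natDegree ≤ 2 * n)
    (hp : ∀ x, 0 ≤ p.eval x) : 0 ≤ L p := by
  induction n generalizing L p with
  | zero =>
    rw [eq_C_of_natDegree_eq_zero (by lia : p.natDegree = 0)] at hp ⊢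
    exact hL.map_C_nonneg (by simpa using hp 0)
  | succ n ih =>
    obtain ⟨m, t, r, hm, hr, hrdeg, rfl⟩ := exists_eq_C_add_sq_mul_of_forall_eval_nonneg hp
    rw [map_add]
    exact add_nonneg (hL.map_C_nonneg hm) (ih (hL.comp_mulLeft_sq t) (by lia) hr)

lemma abs_map_X_pow_le (hL : NonnegOnSplitSquares n L) {k : ℕ} (hk : k ≤ 2 * n) :
    |L (X ^ k)| ≤ L ((1 + X ^ 2) ^ n) := by
  have hX (t : ℝ) : |t ^ k| ≤ (1 + t ^ 2) ^ n := by
    rw [abs_pow, ← sq_abs t]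
    rcases le_total |t| 1 with ht | ht
    · exact (pow_le_one₀ (abs_nonneg t) ht).trans (one_le_pow₀ (by nlinarith))
    · calc |t| ^ k ≤ (|t| ^ 2) ^ n := by rw [← pow_mul]; exact pow_le_pow_right₀ ht hk
        _ ≤ (1 + |t| ^ 2) ^ n := by gcongr; simp
  rw [abs_le', ← sub_nonneg, ← map_sub, ← sub_nonneg (b := -_), sub_neg_eq_add, ← map_add]
  exact ⟨hL.map_nonneg (by compute_degree; lia) fun t ↦ by
      simpa using (le_abs_self _).trans (hX t),
    hL.map_nonneg (by compute_degree; lia) fun t ↦ by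
      simpa [← neg_le_iff_add_nonneg] using (neg_le_abs _).trans (hX t)⟩

lemma mul_le_sum_mul_map_X_pow (hL : NonnegOnSplitSquares n L) {a : Fin (2 * n + 1) → ℝ} {r : ℝ}
    (har : ∀ θ, r ≤ ∑ k, a k * angularMonomial (2 * n) k θ) :
    r * L ((1 + X ^ 2) ^ n) ≤ ∑ k, a k * L (X ^ (k : ℕ)) := by
  set p : ℝ[X] := ∑ k, C (a k) * X ^ (k : ℕ) - C r * (1 + X ^ 2) ^ n with hp
  have hdeg : p.natDegree ≤ 2 * n := by
    refine (natDegree_sub_le_of_le ?_ ?_).trans_eq (max_self _)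
    · exact natDegree_sum_le_of_forall_le _ _ fun k _ ↦
        (natDegree_C_mul_X_pow_le _ _).trans (Fin.is_le k)
    · compute_degree; lia
  have hpos (t : ℝ) : 0 ≤ p.eval t := by
    have h := mul_le_mul_of_nonneg_left (har (LineAngle.ofSlope t))
      (by positivity : 0 ≤ (1 + t ^ 2) ^ n)
    simp_rw [Finset.mul_sum, mul_left_comm _ (a _),
      one_add_sq_pow_mul_angularMonomial_ofSlope (Fin.is_le _)] at h
    simpa [hp, eval_finsetSum, mul_comm r] using h
  have hLp := hL.map_nonneg hdeg hpos
  simpa only [hp, ← smul_eq_C_mul, map_sub, map_sum, map_smul, smul_eq_mul, sub_nonneg] using hLp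

theorem exists_angular_measure (hL : NonnegOnSplitSquares n L) :
    ∃ ρ : ProbabilityMeasure LineAngle, ∀ k ≤ 2 * n,
      L (X ^ k) = L ((1 + X ^ 2) ^ n) *
        ∫ θ, angularMonomial (2 * n) k θ ∂(ρ : Measure LineAngle) := by
  have hs : 0 ≤ L ((1 + X ^ 2) ^ n) :=
    (abs_nonneg _).trans (hL.abs_map_X_pow_le (Nat.zero_le _))
  rcases hs.eq_or_lt with hs | hs
  · refine ⟨⟨Measure.dirac (LineAngle.ofSlope 0), inferInstance⟩, fun k hk ↦ ?_⟩
    simpa [← hs] using hL.abs_map_X_pow_le hk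
  · obtain ⟨ρ, hρ⟩ := exists_probabilityMeasure_forall_integral_eq
      (fun k : Fin (2 * n + 1) ↦ angularMonomial (2 * n) k)
      (fun k ↦ L (X ^ (k : ℕ)) / L ((1 + X ^ 2) ^ n))
      fun a r har ↦ by
        simpa only [← mul_div_assoc, ← Finset.sum_div, le_div_iff₀ hs] using
          hL.mul_le_sum_mul_map_X_pow har
    exact ⟨ρ, fun k hk ↦ by rw [hρ ⟨k, by lia⟩, mul_div_cancel₀ _ hs.ne']⟩

theorem exists_angular_measure_map_pow (hL : NonnegOnSplitSquares n L) :
    ∃ ρ : ProbabilityMeasure LineAngle, ∀ v : ℝ × ℝ, L ((C v.1 + C v.2 * X) ^ (2 * n)) =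
      L ((1 + X ^ 2) ^ n) * ∫ θ, angularForm v θ ^ (2 * n) ∂(ρ : Measure LineAngle) := by
  obtain ⟨ρ, hρ⟩ := hL.exists_angular_measure
  refine ⟨ρ, fun v ↦ ?_⟩
  simp_rw [angularForm_pow_apply, add_C_mul_X_pow]
  rw [integral_finsetSum, map_sum, Finset.mul_sum]
  · refine Finset.sum_congr rfl fun k hk ↦ ?_
    rw [map_smul, hρ k (by simpa [Nat.lt_succ_iff] using hk), integral_const_mul, smul_eq_mul,
      mul_left_comm]
  · exact fun k _ ↦ ((angularMonomial _ k).continuous.integrable_of_hasCompactSupport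
      (.of_compactSpace _)).const_mul _

theorem exists_linearMap_Lp (hL : NonnegOnSplitSquares n L) {p : ENNReal} [hp1 : Fact (1 ≤ p)]
    (hp : p = (2 * n : ℕ)) :
    ∃ T : ℝ × ℝ →ₗ[ℝ] Lp ℝ p (volume.restrict (Set.Ioo (0 : ℝ) 1)),
      ∀ v, ‖T v‖ ^ (2 * n) = L ((C v.1 + C v.2 * X) ^ (2 * n)) := by
  subst hp
  have hn : 2 * n ≠ 0 := by rintro h; simpa [h] using hp1.out
  obtain ⟨ρ, hρ⟩ := hL.exists_angular_measure_map_pow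
  obtain ⟨U⟩ := nonempty_linearIsometry_Lp_Ioo ρ ℝ ℝ (2 * n : ℕ)
  set s := L ((1 + X ^ 2) ^ n)
  have hs : 0 ≤ s := (abs_nonneg _).trans (hL.abs_map_X_pow_le (Nat.zero_le _))
  refine ⟨s ^ ((2 * n : ℕ) : ℝ)⁻¹ • (U.toLinearMap ∘ₗ
    (ContinuousMap.toLp (2 * n : ℕ) (ρ : Measure LineAngle) ℝ).toLinearMap ∘ₗ angularForm),
    fun v ↦ ?_⟩
  have hnorm :
      ‖ContinuousMap.toLp (2 * n : ℕ) (ρ : Measure LineAngle) ℝ (angularForm v)‖ ^ (2 * n) =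
        ∫ θ, angularForm v θ ^ (2 * n) ∂(ρ : Measure LineAngle) :=
    norm_toLp_pow_of_even (even_two_mul n) hn ((angularForm v).memLp _ ℝ)
  rw [LinearMap.smul_apply, norm_smul, mul_pow, norm_of_nonneg (by positivity),
    rpow_inv_natCast_pow hs hn, hρ v, ← hnorm]
  exact congrArg (fun r ↦ s * r ^ (2 * n)) (U.norm_map _)

end NonnegOnSplitSquares

end TruncatedMoments

section QuadraticMaps

open Polynomial
open scoped RealInnerProductSpace

/-- The quadratic map `ℝ² → M` with coefficients `p`, `2q`, `r`. -/
def binaryQuadratic {M : Type*} [AddCommGroup M] [Module ℝ M] (p q r : M) (x y : ℝ) : M :=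
  x ^ 2 • p + (2 * x * y) • q + y ^ 2 • r

lemma map_binaryQuadratic {M N : Type*} [AddCommGroup M] [Module ℝ M] [AddCommGroup N] [Module ℝ N]
    (f : M →ₗ[ℝ] N) (p q r : M) (x y : ℝ) :
    f (binaryQuadratic p q r x y) = binaryQuadratic (f p) (f q) (f r) x y := by
  simp only [binaryQuadratic, map_add, map_smul]

variable {E : Type*} [NormedAddCommGroup E] [InnerProductSpace ℝ E]

/-- The symmetric bilinear map associated with `binaryQuadratic p q r`. -/
def binaryQuadraticPolar (p q r : E) (x y z w : ℝ) : E :=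
  (x * z) • p + (x * w + y * z) • q + (y * w) • r

/-- The functional on polynomials of degree at most four that maps `(x + y X) ^ 4` to
`‖x² p + 2xy q + y² r‖²`. -/
noncomputable def normSqFunctional (p q r : E) : ℝ[X] →ₗ[ℝ] ℝ :=
  ⟪p, p⟫ • lcoeff ℝ 0 + ⟪p, q⟫ • lcoeff ℝ 1 + ((⟪p, r⟫ + 2 * ⟪q, q⟫) / 3) • lcoeff ℝ 2 +
    ⟪q, r⟫ • lcoeff ℝ 3 + ⟪r, r⟫ • lcoeff ℝ 4

lemma normSqFunctional_apply_mul_sq (p q r : E) (x y z w : ℝ) :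
    normSqFunctional p q r (((C x + C y * X) * (C z + C w * X)) ^ 2) =
      (⟪binaryQuadratic p q r x y, binaryQuadratic p q r z w⟫ +
        2 * ‖binaryQuadraticPolar p q r x y z w‖ ^ 2) / 3 := by
  have hexpand : ((C x + C y * X) * (C z + C w * X)) ^ 2 =
      C (x ^ 2 * z ^ 2) + C (2 * x * z * (x * w + y * z)) * X +
        C ((x * w + y * z) ^ 2 + 2 * x * z * y * w) * X ^ 2 +
        C (2 * y * w * (x * w + y * z)) * X ^ 3 + C (y ^ 2 * w ^ 2) * X ^ 4 := by
    simp only [map_add, map_mul, map_pow, map_ofNat]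
    ring
  rw [hexpand, ← real_inner_self_eq_norm_sq]
  simp only [normSqFunctional, binaryQuadratic, binaryQuadraticPolar, LinearMap.add_apply,
    LinearMap.smul_apply, lcoeff_apply, coeff_add, coeff_C_mul, coeff_X, coeff_X_pow, coeff_C,
    inner_add_left, inner_add_right, real_inner_smul_left, real_inner_smul_right,
    real_inner_comm p q, real_inner_comm p r, real_inner_comm q r, smul_eq_mul]
  norm_num
  ring

theorem exists_linearMap_Lp_norm_pow_four {p q r : E} (h : ∀ x y z w,
    0 ≤ ⟪binaryQuadratic p q r x y, binaryQuadratic p q r z w⟫) :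
    ∃ T : ℝ × ℝ →ₗ[ℝ] Lp ℝ 4 (volume.restrict (Set.Ioo (0 : ℝ) 1)),
      ∀ v, ‖T v‖ ^ 4 = ‖binaryQuadratic p q r v.1 v.2‖ ^ 2 := by
  have hL : NonnegOnSplitSquares 2 (normSqFunctional p q r) := fun α β ↦ by
    rw [Fin.prod_univ_two, normSqFunctional_apply_mul_sq]
    have := h (α 0) (β 0) (α 1) (β 1)
    positivity
  have : Fact ((1 : ENNReal) ≤ 4) := ⟨by norm_num⟩
  obtain ⟨T, hT⟩ := hL.exists_linearMap_Lp (p := 4) (by norm_num)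
  refine ⟨T, fun v ↦ (hT v).trans ?_⟩
  have hpolar : binaryQuadraticPolar p q r v.1 v.2 v.1 v.2 = binaryQuadratic p q r v.1 v.2 := by
    simp only [binaryQuadraticPolar, binaryQuadratic]
    module
  rw [pow_mul, sq (C _ + _), normSqFunctional_apply_mul_sq, hpolar, real_inner_self_eq_norm_sq]
  ring

end QuadraticMaps

section HilbertSchmidt

open Module.End
open scoped ENNReal InnerProductSpace

variable {𝕜 E F ι κ : Type*} [RCLike 𝕜] [NormedAddCommGroup E] [InnerProductSpace 𝕜 E]
  [NormedAddCommGroup F] [InnerProductSpace 𝕜 F]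

lemma tsum_enorm_inner_sq (b : HilbertBasis ι 𝕜 E) (x : E) :
    ∑' i, ‖⟪b i, x⟫_𝕜‖ₑ ^ 2 = ‖x‖ₑ ^ 2 := by
  have hsum : HasSum (fun i ↦ ‖⟪b i, x⟫_𝕜‖ ^ 2) (‖x‖ ^ 2) := by
    have h := RCLike.hasSum_re 𝕜 (b.hasSum_inner_mul_inner x x)
    simpa only [inner_mul_symm_re_eq_norm, norm_mul, norm_inner_symm x, ← sq,
      inner_self_eq_norm_sq] using h
  simp only [← ofReal_norm, ← ENNReal.ofReal_pow (norm_nonneg _)]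
  rw [← ENNReal.ofReal_tsum_of_nonneg (fun _ ↦ by positivity) hsum.summable, hsum.tsum_eq]

/-- The square `∑ ‖T bᵢ‖²` of the Hilbert–Schmidt norm, infinite when `T` is not a Hilbert–Schmidt
operator. -/
noncomputable def hilbertSchmidtSq (b : HilbertBasis ι 𝕜 E) (T : E →L[𝕜] F) : ℝ≥0∞ :=
  ∑' i, ‖T (b i)‖ₑ ^ 2

section BasisIndependence

variable [CompleteSpace E] [CompleteSpace F]

lemma hilbertSchmidtSq_adjoint (b : HilbertBasis ι 𝕜 E) (d : HilbertBasis κ 𝕜 F)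
    (T : E →L[𝕜] F) : hilbertSchmidtSq d T.adjoint = hilbertSchmidtSq b T := by
  simp only [hilbertSchmidtSq, ← tsum_enorm_inner_sq b, ← tsum_enorm_inner_sq d (T _)]
  rw [ENNReal.tsum_comm]
  refine tsum_congr fun i ↦ tsum_congr fun j ↦ ?_
  rw [T.adjoint_inner_right, ← ofReal_norm, norm_inner_symm, ofReal_norm]

lemma hilbertSchmidtSq_eq_of_basis (b : HilbertBasis ι 𝕜 E) (d : HilbertBasis κ 𝕜 E)
    (T : E →L[𝕜] F) : hilbertSchmidtSq b T = hilbertSchmidtSq d T := by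
  obtain ⟨_, e, -⟩ := exists_hilbertBasis 𝕜 F
  rw [← hilbertSchmidtSq_adjoint b e, hilbertSchmidtSq_adjoint d e]

end BasisIndependence

theorem exists_hilbertBasis_sigma [CompleteSpace E] {V : κ → Submodule 𝕜 E}
    (hV : OrthogonalFamily 𝕜 (fun k ↦ V k) fun k ↦ (V k).subtypeₗᵢ) (hbot : (⨆ k, V k)ᗮ = ⊥)
    {ι : κ → Type*} (d : ∀ k, HilbertBasis (ι k) 𝕜 (V k)) :
    ∃ b : HilbertBasis (Σ k, ι k) 𝕜 E, ∀ i, b i = d i.1 i.2 := by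
  have hon : Orthonormal 𝕜 fun i : Σ k, ι k ↦ (d i.1 i.2 : E) :=
    hV.orthonormal_sigma_orthonormal fun k ↦ (d k).orthonormal
  refine ⟨.mkOfOrthogonalEqBot hon ?_,
    congrFun (HilbertBasis.coe_mkOfOrthogonalEqBot hon _)⟩
  rw [eq_bot_iff, ← hbot]
  intro x hx
  rw [← Submodule.iInf_orthogonal, Submodule.mem_iInf]
  intro k
  have hzero : (innerSL 𝕜 x).comp (V k).subtypeL = 0 :=
    ContinuousLinearMap.ext_on
      (Submodule.dense_iff_topologicalClosure_eq_top.2 (d k).dense_span) <| by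
      rintro _ ⟨i, rfl⟩
      exact Submodule.inner_left_of_mem_orthogonal
        (Submodule.subset_span (Set.mem_range_self (⟨k, i⟩ : Σ k, ι k))) hx
  exact (Submodule.mem_orthogonal' _ _).2 fun v hv ↦ DFunLike.congr_fun hzero ⟨v, hv⟩

lemma enatCard_eq_finrank [FiniteDimensional 𝕜 E] (b : HilbertBasis ι 𝕜 E) :
    ENat.card ι = Module.finrank 𝕜 E := by
  have := b.orthonormal.linearIndependent.finite
  have := Fintype.ofFinite ι
  rw [Module.finrank_eq_card_basis b.toOrthonormalBasis.toBasis, ENat.card_eq_coe_fintype_card]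

section CompactSymmetric

variable [CompleteSpace E] {T : E →L[𝕜] E}

theorem exists_hilbertBasis_eigenvectors (hT : IsCompactOperator T) (hsymm : T.IsSymmetric) :
    ∃ (w : ∀ μ : 𝕜, Set (eigenspace (T : E →ₗ[𝕜] E) μ)) (b : HilbertBasis (Σ μ, w μ) 𝕜 E),
      (∀ i, T (b i) = i.1 • b i) ∧
        ∀ μ ≠ 0, ENat.card (w μ) = Module.finrank 𝕜 (eigenspace (T : E →ₗ[𝕜] E) μ) := by
  choose w d _ using fun μ : 𝕜 ↦ exists_hilbertBasis 𝕜 (eigenspace (T : E →ₗ[𝕜] E) μ)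
  obtain ⟨b, hb⟩ := exists_hilbertBasis_sigma hsymm.orthogonalFamily_eigenspaces
    (ContinuousLinearMap.orthogonalComplement_iSup_eigenspaces_eq_bot hT hsymm) d
  refine ⟨w, b, fun i ↦ hb i ▸ mem_eigenspace_iff.1 (d i.1 i.2).2, fun μ hμ ↦ ?_⟩
  have := ContinuousLinearMap.finite_dimensional_eigenspace hT μ hμ
  exact enatCard_eq_finrank (d μ)

theorem hilbertSchmidtSq_eq_tsum_finrank_eigenspace (b : HilbertBasis ι 𝕜 E)
    (hT : IsCompactOperator T) (hsymm : T.IsSymmetric) :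
    hilbertSchmidtSq b T =
      ∑' μ : 𝕜, Module.finrank 𝕜 (eigenspace (T : E →ₗ[𝕜] E) μ) * ‖μ‖ₑ ^ 2 := by
  obtain ⟨w, e, he, hcard⟩ := exists_hilbertBasis_eigenvectors hT hsymm
  have hnorm (i : Σ μ, w μ) : ‖T (e i)‖ₑ = ‖i.1‖ₑ := by
    rw [he, enorm_smul, ← ofReal_norm (e i), e.orthonormal.1 i, ENNReal.ofReal_one, mul_one]
  rw [hilbertSchmidtSq_eq_of_basis b e, hilbertSchmidtSq, ENNReal.tsum_sigma']
  simp only [hnorm, ENNReal.tsum_const]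
  refine tsum_congr fun μ ↦ ?_
  rcases eq_or_ne μ 0 with rfl | hμ
  · simp
  · rw [hcard μ hμ, ENat.toENNReal_coe]

theorem hilbertSchmidtSq_le_of_norm_inner_le (b : HilbertBasis ι 𝕜 E) {S : E →L[𝕜] E}
    (hT : IsCompactOperator T) (hsymm : T.IsSymmetric)
    (h : ∀ x, ‖⟪T x, x⟫_𝕜‖ ≤ ‖⟪S x, x⟫_𝕜‖) : hilbertSchmidtSq b T ≤ hilbertSchmidtSq b S := by
  obtain ⟨w, e, he, -⟩ := exists_hilbertBasis_eigenvectors hT hsymm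
  rw [hilbertSchmidtSq_eq_of_basis b e, hilbertSchmidtSq_eq_of_basis b e]
  refine ENNReal.tsum_le_tsum fun i ↦ pow_le_pow_left' (enorm_le_iff_norm_le.2 ?_) 2
  have hunit : ‖e i‖ = 1 := e.orthonormal.1 i
  calc ‖T (e i)‖ = ‖⟪T (e i), e i⟫_𝕜‖ := by
        rw [he, inner_smul_left, inner_self_eq_norm_sq_to_K, hunit, norm_smul, hunit]
        simp
    _ ≤ ‖⟪S (e i), e i⟫_𝕜‖ := h (e i)
    _ ≤ ‖S (e i)‖ := (norm_inner_le_norm _ _).trans_eq (by rw [hunit, mul_one])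

end CompactSymmetric

section Lp

/-- The Hilbert–Schmidt operators from `E` to `F`. -/
def hilbertSchmidtOperators (F : Type*) [NormedAddCommGroup F] [InnerProductSpace 𝕜 F]
    (b : HilbertBasis ι 𝕜 E) : Submodule 𝕜 (E →L[𝕜] F) where
  carrier := {T | Memℓp (fun i ↦ T (b i)) 2}
  zero_mem' := zero_memℓp
  add_mem' := Memℓp.add
  smul_mem' c _ hT := hT.const_smul c

/-- The `ℓ²` family of values on a Hilbert basis, by which the Hilbert–Schmidt operators inherit an
inner product. -/
noncomputable def hilbertSchmidtToLp (F : Type*) [NormedAddCommGroup F] [InnerProductSpace 𝕜 F]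
    (b : HilbertBasis ι 𝕜 E) : hilbertSchmidtOperators F b →ₗ[𝕜] lp (fun _ : ι ↦ F) 2 where
  toFun T := ⟨fun i ↦ T.1 (b i), T.2⟩
  map_add' _ _ := rfl
  map_smul' _ _ := rfl

variable {b : HilbertBasis ι 𝕜 E}

lemma mem_hilbertSchmidtOperators_iff {T : E →L[𝕜] F} :
    T ∈ hilbertSchmidtOperators F b ↔ hilbertSchmidtSq b T ≠ ⊤ := by
  change Memℓp (fun i ↦ T (b i)) 2 ↔ _
  simp only [memℓp_gen_iff (p := 2) (by norm_num), ENNReal.toReal_ofNat, Real.rpow_ofNat]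
  exact (ENNReal.tsum_coe_ne_top_iff_summable_coe (f := fun i ↦ ‖T (b i)‖₊ ^ 2)).symm

lemma norm_hilbertSchmidtToLp_sq (T : hilbertSchmidtOperators F b) :
    ‖hilbertSchmidtToLp F b T‖ ^ 2 = (hilbertSchmidtSq b T.1).toReal := by
  have h := lp.norm_rpow_eq_tsum (p := 2) (by norm_num) (hilbertSchmidtToLp F b T)
  simp only [ENNReal.toReal_ofNat, Real.rpow_ofNat] at h
  rw [h, hilbertSchmidtSq, ENNReal.tsum_toReal_eq fun _ ↦ by finiteness]
  simp only [ENNReal.toReal_pow, toReal_enorm]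
  rfl

theorem re_inner_hilbertSchmidtToLp_nonneg [CompleteSpace E] {P Q : hilbertSchmidtOperators E b}
    (hPc : IsCompactOperator P.1) (hQc : IsCompactOperator Q.1)
    (hP : P.1.IsPositive) (hQ : Q.1.IsPositive) :
    0 ≤ RCLike.re ⟪hilbertSchmidtToLp E b P, hilbertSchmidtToLp E b Q⟫_𝕜 := by
  have hle : hilbertSchmidtSq b (P - Q).1 ≤ hilbertSchmidtSq b (P + Q).1 := by
    refine hilbertSchmidtSq_le_of_norm_inner_le b (hPc.sub hQc)
      (hP.isSymmetric.sub hQ.isSymmetric) fun x ↦ ?_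
    obtain ⟨p, hp, hpx⟩ := RCLike.nonneg_iff_exists_ofReal.1 (hP.inner_nonneg_left x)
    obtain ⟨q, hq, hqx⟩ := RCLike.nonneg_iff_exists_ofReal.1 (hQ.inner_nonneg_left x)
    rw [Submodule.coe_sub, Submodule.coe_add, sub_apply, add_apply, inner_sub_left,
      inner_add_left, ← hpx, ← hqx, ← RCLike.ofReal_sub, ← RCLike.ofReal_add, RCLike.norm_ofReal,
      RCLike.norm_ofReal, abs_of_nonneg (add_nonneg hp hq), abs_sub_le_iff]
    constructor <;> linarith
  have hnorm : ‖hilbertSchmidtToLp E b P - hilbertSchmidtToLp E b Q‖ ^ 2 ≤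
      ‖hilbertSchmidtToLp E b P + hilbertSchmidtToLp E b Q‖ ^ 2 := by
    rw [← map_sub, ← map_add, norm_hilbertSchmidtToLp_sq, norm_hilbertSchmidtToLp_sq]
    exact ENNReal.toReal_mono (mem_hilbertSchmidtOperators_iff.1 (P + Q).2) hle
  rw [@norm_sub_sq 𝕜, @norm_add_sq 𝕜] at hnorm
  linarith

end Lp
end HilbertSchmidt

section Gram

open Module.End
open scoped ComplexOrder ENNReal InnerProductSpace

section RCLike

variable {𝕜 E F : Type*} [RCLike 𝕜] [NormedAddCommGroup E] [InnerProductSpace 𝕜 E]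
  [NormedAddCommGroup F] [InnerProductSpace 𝕜 F]

lemma eigenvalue_nonneg_of_isPositive {T : E →ₗ[𝕜] E} (hT : T.IsPositive) {μ : 𝕜}
    (hμ : HasEigenvalue T μ) : 0 ≤ μ := by
  obtain ⟨r, rfl⟩ := RCLike.conj_eq_iff_real.1 (hT.isSymmetric.conj_eigenvalue_eq_self hμ)
  exact RCLike.ofReal_nonneg.2 (eigenvalue_nonneg_of_nonneg hμ hT.re_inner_nonneg_right)

variable [CompleteSpace E] [CompleteSpace F]

/-- The Gram operator `X* X`. -/
noncomputable def gramOperator (X : E →L[𝕜] F) : E →L[𝕜] E :=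
  X.adjoint ∘L X

lemma isPositive_gramOperator (X : E →L[𝕜] F) : (gramOperator X).IsPositive :=
  X.isPositive_adjoint_comp_self

lemma isCompactOperator_gramOperator {X : E →L[𝕜] F} (hX : IsCompactOperator X) :
    IsCompactOperator (gramOperator X) :=
  hX.clm_comp X.adjoint

lemma inner_gramOperator_self (X : E →L[𝕜] F) (x : E) :
    ⟪gramOperator X x, x⟫_𝕜 = (‖X x‖ ^ 2 : ℝ) := by
  rw [gramOperator, ContinuousLinearMap.comp_apply, ContinuousLinearMap.adjoint_inner_left,
    inner_self_eq_norm_sq_to_K, RCLike.ofReal_pow]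

lemma gramOperator_smul (c : 𝕜) (X : E →L[𝕜] F) :
    gramOperator (c • X) = (‖c‖ ^ 2 : 𝕜) • gramOperator X := by
  rw [gramOperator, map_smulₛₗ, ContinuousLinearMap.smul_comp, ContinuousLinearMap.comp_smul,
    smul_smul, RCLike.conj_mul, gramOperator]

theorem gramOperator_add_mem_hilbertSchmidtOperators {ι : Type*} {b : HilbertBasis ι 𝕜 E}
    {X Y : E →L[𝕜] F} (hXc : IsCompactOperator X) (hYc : IsCompactOperator Y)
    (hX : gramOperator X ∈ hilbertSchmidtOperators E b)
    (hY : gramOperator Y ∈ hilbertSchmidtOperators E b) :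
    gramOperator (X + Y) ∈ hilbertSchmidtOperators E b := by
  have hmem := mem_hilbertSchmidtOperators_iff.1 (add_mem (add_mem hX hX) (add_mem hY hY))
  refine mem_hilbertSchmidtOperators_iff.2 (ne_top_of_le_ne_top hmem ?_)
  refine hilbertSchmidtSq_le_of_norm_inner_le b (isCompactOperator_gramOperator (hXc.add hYc))
    (isPositive_gramOperator _).isSymmetric fun v ↦ ?_
  simp only [add_apply, inner_add_left, inner_gramOperator_self, ← RCLike.ofReal_add,
    RCLike.norm_ofReal]
  rw [abs_of_nonneg (by positivity), abs_of_nonneg (by positivity)]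
  have hsq := pow_le_pow_left₀ (norm_nonneg _) (norm_add_le (X v) (Y v)) 2
  linarith [add_sq_le (a := ‖X v‖) (b := ‖Y v‖)]

end RCLike

variable {H : Type*} [NormedAddCommGroup H] [InnerProductSpace ℂ H] [CompleteSpace H]
  {ι : Type*} {X : H →L[ℂ] H}

lemma singularValue_pos (i : SingularIndex X) : 0 < singularValue X i :=
  i.1.2

lemma schattenNorm_nonneg (p : ℝ) : 0 ≤ schattenNorm p X :=
  Real.rpow_nonneg (tsum_nonneg fun i ↦ Real.rpow_nonneg (singularValue_pos i).le p) _

lemma tsum_singularValue (f : ℝ → ℝ≥0∞) :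
    ∑' i : SingularIndex X, f (singularValue X i) =
      ∑' s : {s : ℝ // 0 < s}, Module.finrank ℂ (singularSpace X s) * f s := by
  refine (ENNReal.tsum_sigma' _).trans (tsum_congr fun s ↦ ?_)
  simp only [singularValue]
  rw [ENNReal.tsum_const, ENat.card_eq_coe_fintype_card, Fintype.card_fin, ENat.toENNReal_coe]

theorem tsum_singularValue_pow_four (b : HilbertBasis ι ℂ H) (hX : IsCompactOperator X) :
    ∑' i, ENNReal.ofReal (singularValue X i ^ 4) = hilbertSchmidtSq b (gramOperator X) := by
  have hpos := isPositive_gramOperator X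
  rw [tsum_singularValue fun s ↦ ENNReal.ofReal (s ^ 4),
    hilbertSchmidtSq_eq_tsum_finrank_eigenspace b (isCompactOperator_gramOperator hX)
      hpos.isSymmetric]
  have hinj : Function.Injective fun s : {s : ℝ // 0 < s} ↦ ((s : ℝ) : ℂ) ^ 2 := fun s t hst ↦ by
    have hsq : (s : ℝ) ^ 2 = (t : ℝ) ^ 2 := Complex.ofReal_injective (by simpa using hst)
    exact Subtype.ext ((pow_left_inj₀ s.2.le t.2.le two_ne_zero).1 hsq)
  refine .trans (tsum_congr fun s ↦ ?_) (hinj.tsum_eq fun μ hμ ↦ ?_)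
  · rw [enorm_pow, ← pow_mul, ENNReal.ofReal_pow s.2.le, ← ofReal_norm, Complex.norm_real,
      Real.norm_of_nonneg s.2.le]
    rfl
  · obtain ⟨hfinrank, hμ0⟩ := mul_ne_zero_iff.1 hμ
    have heigen : HasEigenvalue (gramOperator X : H →ₗ[ℂ] H) μ :=
      hasEigenvalue_iff.2 fun hbot ↦ hfinrank (by rw [hbot, finrank_bot, Nat.cast_zero])
    obtain ⟨r, hr, rfl⟩ := RCLike.nonneg_iff_exists_ofReal.1
      (eigenvalue_nonneg_of_isPositive hpos heigen)
    have hr0 : 0 < r := hr.lt_of_ne (by rintro rfl; simp at hμ0)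
    exact ⟨⟨√r, Real.sqrt_pos.2 hr0⟩,
      (Complex.ofReal_pow _ 2).symm.trans (congrArg _ (Real.sq_sqrt hr))⟩

theorem memSchatten_four_iff (b : HilbertBasis ι ℂ H) :
    MemSchatten 4 X ↔ IsCompactOperator X ∧ gramOperator X ∈ hilbertSchmidtOperators H b := by
  refine and_congr_right fun hX ↦ ?_
  rw [mem_hilbertSchmidtOperators_iff, ← tsum_singularValue_pow_four b hX]
  simp only [Real.rpow_ofNat]
  refine ⟨Summable.tsum_ofReal_ne_top, fun h ↦ ?_⟩
  simpa only [ENNReal.toReal_ofReal (pow_nonneg (singularValue_pos _).le 4)] using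
    ENNReal.summable_toReal h

theorem schattenNorm_four_pow (b : HilbertBasis ι ℂ H) (hX : IsCompactOperator X) :
    schattenNorm 4 X ^ 4 = (hilbertSchmidtSq b (gramOperator X)).toReal := by
  have hnonneg (i : SingularIndex X) : 0 ≤ singularValue X i ^ 4 :=
    pow_nonneg (singularValue_pos i).le 4
  rw [← tsum_singularValue_pow_four b hX, ENNReal.tsum_toReal_eq fun _ ↦ ENNReal.ofReal_ne_top]
  simp only [ENNReal.toReal_ofReal (hnonneg _), schattenNorm, Real.rpow_ofNat]
  rw [one_div, ← Nat.cast_ofNat (R := ℝ),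
    Real.rpow_inv_natCast_pow (tsum_nonneg hnonneg) four_ne_zero]

lemma memSchatten_four_add {A B : H →L[ℂ] H} (hA : MemSchatten 4 A) (hB : MemSchatten 4 B) :
    MemSchatten 4 (A + B) := by
  obtain ⟨_, b, -⟩ := exists_hilbertBasis ℂ H
  rw [memSchatten_four_iff b] at hA hB ⊢
  exact ⟨hA.1.add hB.1, gramOperator_add_mem_hilbertSchmidtOperators hA.1 hB.1 hA.2 hB.2⟩

lemma memSchatten_four_smul (c : ℂ) {A : H →L[ℂ] H} (hA : MemSchatten 4 A) :
    MemSchatten 4 (c • A) := by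
  obtain ⟨_, b, -⟩ := exists_hilbertBasis ℂ H
  rw [memSchatten_four_iff b] at hA ⊢
  exact ⟨hA.1.smul c, gramOperator_smul c A ▸ Submodule.smul_mem _ _ hA.2⟩

/-- The symmetrization `(A* B + B* A) / 2` of the sesquilinear map behind `gramOperator`. -/
noncomputable def symmGramOperator (A B : H →L[ℂ] H) : H →L[ℂ] H :=
  (2⁻¹ : ℝ) • (A.adjoint ∘L B + B.adjoint ∘L A)

lemma gramOperator_smul_add_smul (A B : H →L[ℂ] H) (x y : ℝ) :
    gramOperator (x • A + y • B) =
      binaryQuadratic (gramOperator A) (symmGramOperator A B) (gramOperator B) x y := by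
  have hadj : (x • A + y • B).adjoint = x • A.adjoint + y • B.adjoint := by
    simp only [← Complex.coe_smul, map_add, map_smulₛₗ, Complex.conj_ofReal]
  simp only [gramOperator, symmGramOperator, binaryQuadratic, hadj, ContinuousLinearMap.add_comp,
    ContinuousLinearMap.comp_add, ContinuousLinearMap.smul_comp, ContinuousLinearMap.comp_smul]
  module

lemma symmGramOperator_mem_hilbertSchmidtOperators {b : HilbertBasis ι ℂ H} {A B : H →L[ℂ] H}
    (hA : MemSchatten 4 A) (hB : MemSchatten 4 B) :
    symmGramOperator A B ∈ hilbertSchmidtOperators H b := by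
  have hpolar : symmGramOperator A B =
      (2⁻¹ : ℝ) • (gramOperator (A + B) - gramOperator A - gramOperator B) := by
    have hadd := gramOperator_smul_add_smul A B 1 1
    simp only [one_smul, binaryQuadratic] at hadd
    rw [hadd]
    module
  have hmem {X : H →L[ℂ] H} (hX : MemSchatten 4 X) :
      gramOperator X ∈ hilbertSchmidtOperators H b := ((memSchatten_four_iff b).1 hX).2
  rw [hpolar]
  exact Submodule.smul_of_tower_mem _ _
    (sub_mem (sub_mem (hmem (memSchatten_four_add hA hB)) (hmem hA)) (hmem hB))

end Gram

section Schatten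

open scoped InnerProductSpace

variable {H : Type*} [NormedAddCommGroup H] [InnerProductSpace ℂ H] [CompleteSpace H]
  {A B : H →L[ℂ] H}

lemma memSchatten_four_smul_add_smul (hA : MemSchatten 4 A) (hB : MemSchatten 4 B) (x y : ℝ) :
    MemSchatten 4 (x • A + y • B) :=
  memSchatten_four_add (memSchatten_four_smul x hA) (memSchatten_four_smul y hB)

theorem exists_linearMap_norm_eq_schattenNorm_four (hA : MemSchatten 4 A) (hB : MemSchatten 4 B) :
    ∃ T : ℝ × ℝ →ₗ[ℝ] Lp ℝ 4 (volume.restrict (Set.Ioo (0 : ℝ) 1)),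
      ∀ v, ‖T v‖ = schattenNorm 4 (v.1 • A + v.2 • B) := by
  obtain ⟨w, b, -⟩ := exists_hilbertBasis ℂ H
  let _ : InnerProductSpace ℝ (lp (fun _ : w ↦ H) 2) := InnerProductSpace.complexToReal
  have hcomb (x y : ℝ) := (memSchatten_four_iff b).1 (memSchatten_four_smul_add_smul hA hB x y)
  let φ : hilbertSchmidtOperators H b →ₗ[ℝ] lp (fun _ : w ↦ H) 2 :=
    (hilbertSchmidtToLp H b).restrictScalars ℝ
  let p : hilbertSchmidtOperators H b := ⟨_, ((memSchatten_four_iff b).1 hA).2⟩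
  let q : hilbertSchmidtOperators H b := ⟨_, symmGramOperator_mem_hilbertSchmidtOperators hA hB⟩
  let r : hilbertSchmidtOperators H b := ⟨_, ((memSchatten_four_iff b).1 hB).2⟩
  have hgram (x y : ℝ) : binaryQuadratic (φ p) (φ q) (φ r) x y =
      hilbertSchmidtToLp H b ⟨gramOperator (x • A + y • B), (hcomb x y).2⟩ := by
    rw [← map_binaryQuadratic]
    exact congrArg φ (Subtype.ext (gramOperator_smul_add_smul A B x y).symm)
  have hnonneg (x y z t : ℝ) :
      0 ≤ ⟪binaryQuadratic (φ p) (φ q) (φ r) x y, binaryQuadratic (φ p) (φ q) (φ r) z t⟫_ℝ := by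
    rw [hgram, hgram]
    exact re_inner_hilbertSchmidtToLp_nonneg (isCompactOperator_gramOperator (hcomb x y).1)
      (isCompactOperator_gramOperator (hcomb z t).1) (isPositive_gramOperator _)
      (isPositive_gramOperator _)
  obtain ⟨T, hT⟩ := exists_linearMap_Lp_norm_pow_four hnonneg
  have : Fact ((1 : ENNReal) ≤ 4) := ⟨by norm_num⟩
  refine ⟨T, fun v ↦ (pow_left_inj₀ (norm_nonneg _) (schattenNorm_nonneg _) four_ne_zero).1 ?_⟩
  refine (hT v).trans ((congrArg (‖·‖ ^ 2) (hgram v.1 v.2)).trans ?_)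
  rw [norm_hilbertSchmidtToLp_sq, schattenNorm_four_pow b (hcomb v.1 v.2).1]

end Schatten

lemma exists_linearMap_span_pair {K M : Type*} [DivisionRing K] [AddCommGroup M] [Module K M]
    (a b : M) : ∃ g : Submodule.span K {a, b} →ₗ[K] K × K,
      ∀ x : Submodule.span K {a, b}, (x : M) = (g x).1 • a + (g x).2 • b := by
  let φ : K × K →ₗ[K] M :=
    (LinearMap.toSpanSingleton K M a).coprod (LinearMap.toSpanSingleton K M b)
  have hrange : LinearMap.range φ = Submodule.span K {a, b} := by
    ext; simp [φ, Submodule.mem_span_pair]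
  obtain ⟨g, hg⟩ := φ.rangeRestrict.exists_rightInverse_of_surjective φ.range_rangeRestrict
  refine ⟨g ∘ₗ (LinearEquiv.ofEq _ _ hrange.symm : _ →ₗ[K] _), fun x ↦ ?_⟩
  exact (congrArg Subtype.val (LinearMap.congr_fun hg (LinearEquiv.ofEq _ _ hrange.symm x))).symm

theorem mainTheorem7_general {H : Type*} [NormedAddCommGroup H] [InnerProductSpace ℂ H]
    [CompleteSpace H] (A B : H →L[ℂ] H) (hA : MemSchatten 4 A) (hB : MemSchatten 4 B) :
    ∃ T : Submodule.span ℝ ({A, B} : Set (H →L[ℂ] H)) →ₗ[ℝ]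
        Lp ℝ 4 (volume.restrict (Set.Ioo (0 : ℝ) 1)),
      ∀ X : Submodule.span ℝ ({A, B} : Set (H →L[ℂ] H)),
        MemSchatten 4 (X : H →L[ℂ] H) ∧ ‖T X‖ = schattenNorm 4 (X : H →L[ℂ] H) := by
  obtain ⟨T, hT⟩ := exists_linearMap_norm_eq_schattenNorm_four hA hB
  obtain ⟨g, hg⟩ := exists_linearMap_span_pair (K := ℝ) A B
  refine ⟨T ∘ₗ g, fun X ↦ ?_⟩
  rw [hg X]
  exact ⟨memSchatten_four_smul_add_smul hA hB _ _, hT (g X)⟩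

theorem mainTheorem7 {H : Type*} [NormedAddCommGroup H] [InnerProductSpace ℂ H] [CompleteSpace H]
    [TopologicalSpace.SeparableSpace H] (A B : H →L[ℂ] H)
    (hA : MemSchatten 4 A) (hB : MemSchatten 4 B) :
    ∃ T : Submodule.span ℝ ({A, B} : Set (H →L[ℂ] H)) →ₗ[ℝ]
        Lp ℝ 4 (volume.restrict (Set.Ioo (0 : ℝ) 1)),
      ∀ X : Submodule.span ℝ ({A, B} : Set (H →L[ℂ] H)),
        MemSchatten 4 (X : H →L[ℂ] H) ∧ ‖T X‖ = schattenNorm 4 (X : H →L[ℂ] H) :=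
  mainTheorem7_general A B hA hB
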